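/- Let $M,S,L\ge 1$ be integers, and let $\Psi\in\mathbb{C}^{M\times S}$ be a frame, that is, the matrix whose $j$-th row is $\psi_j^*$, where $\psi_1,\dots,\psi_M$ span $\mathbb{C}^S$. Let $\mathcal{A}\subset\mathbb{C}$ be any alphabet with exactly $L$ elements, and let $Q\colon\mathbb{C}^M\to\mathcal{A}^M$ be memoryless scalar quantization: $Q(y)_j=r_j(y_j)$ for $j=1,\dots,M$, where each $r_j\colon\mathbb{C}\to\mathcal{A}$ maps every $w\in\mathbb{C}$ to an element of $\mathcal{A}$ that is nearest to $w$ with respect to $|\cdot|$, ties being broken arbitrarily. Let $B_S=\{z\in\mathbb{C}^S:\|z\|_2\le 1\}$ and $$\mathcal{E}(\Psi,\mathcal{A}):=\inf_{D\colon\mathcal{A}^M\to\mathbb{C}^S}\ \sup_{z\in B_S}\ \|z-D(Q(\Psi z))\|_2,$$ where the infimum is over all maps $D$. Then $$\mathcal{E}(\Psi,\mathcal{A})\ \ge\ \min\left(\frac14,\ \frac{S}{3eLM}\right).$$ -/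

import Mathlib

open scoped Matrix

noncomputable section

/-- An `M × S` complex matrix `Ψ`, with `j`-th row `ψ_j^*`, is a frame when the vectors `ψ_j`
(the columns of the conjugate transpose of `Ψ`) span `ℂ^S`. -/
def IsFrameMatrix {M S : ℕ} (Ψ : Matrix (Fin M) (Fin S) ℂ) : Prop :=
  Submodule.span ℂ (Set.range Ψᴴ.col) = ⊤

/-- `r` rounds every complex number to a nearest element of the alphabet `A`; ties are broken
arbitrarily. -/
def IsNearestRounding (A : Finset ℂ) (r : ℂ → A) : Prop :=
  ∀ w : ℂ, ∀ a ∈ A, ‖w - (r w : ℂ)‖ ≤ ‖w - a‖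

/-- `Q` is a memoryless scalar quantizer with alphabet `A`: the `j`-th entry of `Q y` is obtained
by rounding the `j`-th entry of `y` to a nearest element of `A`. The way in which ties are broken
is arbitrary and may differ from one entry to another. -/
def IsMSQ {M : ℕ} (A : Finset ℂ) (Q : (Fin M → ℂ) → (Fin M → A)) : Prop :=
  ∃ r : Fin M → ℂ → A, (∀ j, IsNearestRounding A (r j)) ∧ ∀ y j, Q y j = r j (y j)

/-- The minimax error `inf_D sup_{‖z‖₂ ≤ 1} ‖z - D (Q (Ψ z))‖₂`, the infimum being over all maps
`D : A^M → ℂ^S`. It is taken in `[0, ∞]`, so that the infimum and the supremum are genuine. -/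
def minimaxError {M S : ℕ} {A : Finset ℂ} (Ψ : Matrix (Fin M) (Fin S) ℂ)
    (Q : (Fin M → ℂ) → (Fin M → A)) : ENNReal :=
  ⨅ D : (Fin M → A) → EuclideanSpace ℂ (Fin S),
    ⨆ z ∈ Metric.closedBall (0 : EuclideanSpace ℂ (Fin S)) 1, ‖z - D (Q (Ψ *ᵥ z.ofLp))‖ₑ

end

/-!
Each row of `Ψ` and its quantizer cut `ℂ^S` into preimages of the Voronoi cells of the alphabet. By
planarity these are separated by only `3 * L` bisectors, although there are of the order of `L ^ 2`
pairs of letters. So all the rows together need at most `n = 3 * L * M` real affine hyperplanes in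
dimension `d = 2 * S`, and off these hyperplanes `Q (Ψ z)` depends only on the open cell of the
arrangement containing `z`.

There are at most `∑ k ≤ d, n.choose k` such cells (`card_signPatterns_le`). Any decoder sends each
cell to one point, so an error of at most `ε` covers the unit ball, up to a null set, by as many balls
of radius `ε`, and their number times `ε ^ d` is at least `1` (`one_le_sum_choose_mul_pow`). Since the
number of cells is at most `(e * n / d) ^ d` if `d ≤ n`, and at most `2 ^ d` otherwise, `ε` is at
least `d / (e * n) = 2 * S / (3 * e * L * M)` or `1 / 2`, which is twice what is claimed.

The linear number of bisectors (`exists_separating_pairs`) is obtained without Euler's formula, by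
sweeping a horizontal line over the plane. The line meets the cells in the order of the real parts of
their centres, and by convexity each cell appears and disappears once. An appearance creates at
most two new pairs of neighbours and a disappearance at most one, which gives `3 * L` pairs
(`card_consecutive_pairs_le`).
-/

/-! ### Pairs that become consecutive in a changing ordered set -/

/-- Elements of `A` are ordered by `key`, and each is active during an interval of times. At most
`3 * A.card` pairs are ever consecutive among the active elements.

The number of consecutive pairs changes only when an element appears or disappears: an appearance
creates at most two new pairs, and a disappearance at most one. Formally, a pair is charged, at the
first time it is consecutive, to its left end if that end has just appeared, to its right end if
that one has, and otherwise to an element that separated the two ends and has just disappeared. -/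
theorem card_consecutive_pairs_le {α τ : Type*} [LinearOrder τ] [Nonempty τ] (A : Finset α)
    (key : α → ℝ) (hkey : Set.InjOn key A) (active : τ → α → Prop)
    (hactive : ∀ a, {t | active t a}.OrdConnected) (E : Finset (α × α))
    (hEA : ∀ e ∈ E, e.1 ∈ A ∧ e.2 ∈ A)
    (hE : ∀ e ∈ E, ∃ t, active t e.1 ∧ active t e.2 ∧ key e.1 < key e.2 ∧
      ∀ c ∈ A, active t c → ¬ (key e.1 < key c ∧ key c < key e.2)) :
    E.card ≤ 3 * A.card := by
  classical
  let Adj : τ → α × α → Prop := fun t e ↦ active t e.1 ∧ active t e.2 ∧ key e.1 < key e.2 ∧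
      ∀ c ∈ A, active t c → ¬ (key e.1 < key c ∧ key c < key e.2)
  choose! time htime using hE
  -- One witnessing time per pair suffices, so only the finitely many times in `T` matter.
  let T : Finset τ := E.image time
  have hfirst : ∀ e ∈ E, ∃ t ∈ T, Adj t e ∧ ∀ s ∈ T, s < t → ¬ Adj s e := by
    intro e he
    obtain ⟨t, ht, hmin⟩ := (T.filter (Adj · e)).exists_min_image id
      ⟨time e, Finset.mem_filter.2 ⟨Finset.mem_image_of_mem _ he, htime e he⟩⟩
    rw [Finset.mem_filter] at ht
    refine ⟨t, ht.1, ht.2, fun s hs hst hadj ↦ ?_⟩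
    exact absurd (hmin s (Finset.mem_filter.2 ⟨hs, hadj⟩)) (not_le.2 hst)
  choose! first hfT hfAdj hfmin using hfirst
  have key_eq : ∀ {a b}, a ∈ A → b ∈ A → ¬ key a < key b → ¬ key b < key a → a = b :=
    fun ha hb h₁ h₂ ↦ hkey ha hb (le_antisymm (not_lt.1 h₂) (not_lt.1 h₁))
  let E₁ := E.filter fun e ↦ ∀ s ∈ T, s < first e → ¬ active s e.1
  let E₂ := E.filter fun e ↦ ∀ s ∈ T, s < first e → ¬ active s e.2
  -- The time `s` below is the predecessor of `first e` in `T`: at `s` the element `c` still separates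
  -- the two ends, and at `first e` it no longer does.
  let E₃ := E.filter fun e ↦ ∃ c ∈ A, (key e.1 < key c ∧ key c < key e.2) ∧
    ¬ active (first e) c ∧ ∃ s ∈ T, s < first e ∧ active s c ∧ ∀ s' ∈ T, s' < first e → s' ≤ s
  have hcover : E ⊆ E₁ ∪ E₂ ∪ E₃ := by
    intro e he
    simp only [E₁, E₂, E₃, Finset.mem_union, Finset.mem_filter, he, true_and]
    by_contra! hcon
    obtain ⟨⟨⟨s₁, hs₁, hs₁t, ha₁⟩, ⟨s₂, hs₂, hs₂t, ha₂⟩⟩, h₃⟩ := hcon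
    obtain ⟨s, hs, hmax⟩ := (T.filter (· < first e)).exists_max_image id
      ⟨s₁, Finset.mem_filter.2 ⟨hs₁, hs₁t⟩⟩
    rw [Finset.mem_filter] at hs
    have hle : ∀ s' ∈ T, s' < first e → s' ≤ s :=
      fun s' h h' ↦ hmax s' (Finset.mem_filter.2 ⟨h, h'⟩)
    obtain ⟨h1, h2, hlt, hgap⟩ := hfAdj e he
    have hs1 : active s e.1 := (hactive e.1).out ha₁ h1 ⟨hle _ hs₁ hs₁t, hs.2.le⟩
    have hs2 : active s e.2 := (hactive e.2).out ha₂ h2 ⟨hle _ hs₂ hs₂t, hs.2.le⟩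
    have hnot := hfmin e he s hs.1 hs.2
    have : ∃ c ∈ A, active s c ∧ (key e.1 < key c ∧ key c < key e.2) := by
      by_contra! hc
      exact hnot ⟨hs1, hs2, hlt, fun c hc' hac hk ↦ (hc c hc' hac hk.1).not_gt hk.2⟩
    obtain ⟨c, hcA, hc, hk⟩ := this
    obtain ⟨s', hs', hlt', hgt'⟩ := h₃ c hcA hk (fun h ↦ hgap c hcA h hk) s hs.1 hs.2 hc
    exact (hle s' hs' hlt').not_gt hgt'
  have h₁ : E₁.card ≤ A.card := by
    refine Finset.card_le_card_of_injOn Prod.fst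
      (fun e he ↦ (hEA e (Finset.mem_filter.1 he).1).1) ?_
    intro e he e' he' hee
    rw [Finset.mem_coe, Finset.mem_filter] at he he'
    have ht : first e = first e' := by
      refine le_antisymm (not_lt.1 fun h ↦ ?_) (not_lt.1 fun h ↦ ?_)
      · exact he.2 _ (hfT e' he'.1) h (hee ▸ (hfAdj e' he'.1).1)
      · exact he'.2 _ (hfT e he.1) h (hee ▸ (hfAdj e he.1).1)
    obtain ⟨a1, a2, a3, a4⟩ := hfAdj e he.1
    obtain ⟨b1, b2, b3, b4⟩ := hfAdj e' he'.1
    rw [← ht] at b1 b2 b4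
    refine Prod.ext hee (key_eq (hEA e he.1).2 (hEA e' he'.1).2 (fun h ↦ ?_) fun h ↦ ?_)
    · exact b4 _ (hEA e he.1).2 a2 ⟨hee ▸ a3, h⟩
    · exact a4 _ (hEA e' he'.1).2 b2 ⟨hee ▸ b3, h⟩
  have h₂ : E₂.card ≤ A.card := by
    refine Finset.card_le_card_of_injOn Prod.snd
      (fun e he ↦ (hEA e (Finset.mem_filter.1 he).1).2) ?_
    intro e he e' he' hee
    rw [Finset.mem_coe, Finset.mem_filter] at he he'
    have ht : first e = first e' := by
      refine le_antisymm (not_lt.1 fun h ↦ ?_) (not_lt.1 fun h ↦ ?_)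
      · exact he.2 _ (hfT e' he'.1) h (hee ▸ (hfAdj e' he'.1).2.1)
      · exact he'.2 _ (hfT e he.1) h (hee ▸ (hfAdj e he.1).2.1)
    obtain ⟨a1, a2, a3, a4⟩ := hfAdj e he.1
    obtain ⟨b1, b2, b3, b4⟩ := hfAdj e' he'.1
    rw [← ht] at b1 b2 b4
    refine Prod.ext (key_eq (hEA e he.1).1 (hEA e' he'.1).1 (fun h ↦ ?_) fun h ↦ ?_) hee
    · exact a4 _ (hEA e' he'.1).1 b1 ⟨h, hee ▸ b3⟩
    · exact b4 _ (hEA e he.1).1 a1 ⟨h, hee ▸ a3⟩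
  have h₃ : E₃.card ≤ A.card := by
    refine Finset.card_le_card_of_forall_subsingleton
      (fun e c ↦ (key e.1 < key c ∧ key c < key e.2) ∧
        ¬ active (first e) c ∧ ∃ s ∈ T, s < first e ∧ active s c ∧
          ∀ s' ∈ T, s' < first e → s' ≤ s) (fun e he ↦ (Finset.mem_filter.1 he).2) ?_
    rintro c hc e ⟨he, hek, hen, s, hsT, hs, hsa, hsmax⟩
      e' ⟨he', hek', hen', s', hsT', hs', hsa', hsmax'⟩
    replace he := (Finset.mem_filter.1 he).1
    replace he' := (Finset.mem_filter.1 he').1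
    -- `c` is activated only once, so it cannot disappear at two different times.
    have ht : first e = first e' := by
      refine le_antisymm (not_lt.1 fun h ↦ ?_) (not_lt.1 fun h ↦ ?_)
      · exact hen' ((hactive c).out hsa' hsa ⟨hs'.le, hsmax _ (hfT e' he') h⟩)
      · exact hen ((hactive c).out hsa hsa' ⟨hs.le, hsmax' _ (hfT e he) h⟩)
    obtain ⟨a1, a2, a3, a4⟩ := hfAdj e he
    obtain ⟨b1, b2, b3, b4⟩ := hfAdj e' he'
    rw [← ht] at b1 b2 b4
    refine Prod.ext (key_eq (hEA e he).1 (hEA e' he').1 (fun h ↦ ?_) fun h ↦ ?_)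
      (key_eq (hEA e he).2 (hEA e' he').2 (fun h ↦ ?_) fun h ↦ ?_)
    · exact a4 _ (hEA e' he').1 b1 ⟨h, hek'.1.trans hek.2⟩
    · exact b4 _ (hEA e he).1 a1 ⟨h, hek.1.trans hek'.2⟩
    · exact b4 _ (hEA e he).2 a2 ⟨hek'.1.trans hek.2, h⟩
    · exact a4 _ (hEA e' he').2 b2 ⟨hek.1.trans hek'.2, h⟩
  have := Finset.card_le_card hcover
  have := Finset.card_union_le (E₁ ∪ E₂) E₃
  have := Finset.card_union_le E₁ E₂
  omega

/-! ### Separating planar Voronoi cells by linearly many bisectors -/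

section Voronoi

open Filter Topology

theorem norm_sub_le_norm_sub_iff (w a b : ℂ) : ‖w - a‖ ≤ ‖w - b‖ ↔
    (w.re - a.re) ^ 2 + (w.im - a.im) ^ 2 ≤ (w.re - b.re) ^ 2 + (w.im - b.im) ^ 2 := by
  rw [← sq_le_sq₀ (norm_nonneg _) (norm_nonneg _), ← Complex.normSq_eq_norm_sq,
    ← Complex.normSq_eq_norm_sq, Complex.normSq_apply, Complex.normSq_apply]
  simp only [Complex.sub_re, Complex.sub_im, sq]

/-- The point `x + t * I` is strictly closer to `a` than to every other element of `A`. Squared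
distances are written in coordinates, so that their differences are visibly affine in `(x, t)`.
Membership `a ∈ A` is not part of the definition. -/
def IsStrictlyNearest (A : Finset ℂ) (a : ℂ) (x t : ℝ) : Prop :=
  ∀ b ∈ A, b ≠ a → (x - a.re) ^ 2 + (t - a.im) ^ 2 < (x - b.re) ^ 2 + (t - b.im) ^ 2

/-- The heights at which a horizontal line meets the open Voronoi cell of `a` form an interval,
as this set is a projection of a convex set. -/
theorem convex_heights (A : Finset ℂ) (a : ℂ) :
    Convex ℝ {t : ℝ | ∃ x, IsStrictlyNearest A a x t} := by
  rintro t₁ ⟨x₁, h₁⟩ t₂ ⟨x₂, h₂⟩ α β hα hβ hαβ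
  refine ⟨α * x₁ + β * x₂, fun b hb hba ↦ ?_⟩
  have h₁ := sub_pos.2 (h₁ b hb hba)
  have h₂ := sub_pos.2 (h₂ b hb hba)
  obtain rfl : β = 1 - α := by linarith
  simp only [smul_eq_mul]
  rw [← sub_pos]
  have key : 0 < α * ((x₁ - b.re) ^ 2 + (t₁ - b.im) ^ 2 - ((x₁ - a.re) ^ 2 + (t₁ - a.im) ^ 2)) +
      (1 - α) * ((x₂ - b.re) ^ 2 + (t₂ - b.im) ^ 2 - ((x₂ - a.re) ^ 2 + (t₂ - a.im) ^ 2)) := by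
    rcases hα.eq_or_lt with rfl | hα
    · simpa using h₂
    · have := mul_pos hα h₁
      have := mul_nonneg hβ h₂.le
      linarith
  convert key using 1
  ring

/-- If `a` is nearest to `u` and all elements tied with it lie on the same horizontal side of it, then
moving slightly from `u` in the horizontal direction `σ` away from them breaks the ties in favour
of `a`. -/
theorem exists_isStrictlyNearest {A : Finset ℂ} {a u : ℂ} {σ : ℝ}
    (ha : ∀ b ∈ A, ‖u - a‖ ≤ ‖u - b‖)
    (hσ : ∀ b ∈ A, b ≠ a → ‖u - b‖ = ‖u - a‖ → 0 < σ * (a.re - b.re)) :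
    ∃ x, IsStrictlyNearest A a x u.im := by
  have hev : ∀ b ∈ A, ∀ᶠ ε in 𝓝[>] (0 : ℝ), b ≠ a →
      (u.re + ε * σ - a.re) ^ 2 + (u.im - a.im) ^ 2 <
        (u.re + ε * σ - b.re) ^ 2 + (u.im - b.im) ^ 2 := by
    intro b hb
    by_cases hba : b = a
    · simp [hba]
    have hle := (norm_sub_le_norm_sub_iff u a b).1 (ha b hb)
    rcases hle.lt_or_eq with hlt | heq
    · have hc : ContinuousAt (fun ε : ℝ ↦ (u.re + ε * σ - b.re) ^ 2 + (u.im - b.im) ^ 2 -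
          ((u.re + ε * σ - a.re) ^ 2 + (u.im - a.im) ^ 2)) 0 := by fun_prop
      have h0 := hc.eventually (lt_mem_nhds (a := (0 : ℝ)) (by simpa using hlt))
      filter_upwards [mem_nhdsWithin_of_mem_nhds h0] with ε hε _
      exact sub_pos.1 hε
    · have hn : ‖u - b‖ = ‖u - a‖ :=
        le_antisymm ((norm_sub_le_norm_sub_iff u b a).2 heq.ge) (ha b hb)
      filter_upwards [self_mem_nhdsWithin] with ε hε _
      have := mul_pos (Set.mem_Ioi.1 hε) (hσ b hb hba hn)
      nlinarith
  obtain ⟨ε, hε⟩ := ((Finset.eventually_all A).2 hev).exists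
  exact ⟨u.re + ε * σ, hε⟩

/-- A segment that leaves the closed Voronoi cell of `p` has a point at which `p` is tied with another
nearest element. -/
theorem exists_tie_of_segment {A : Finset ℂ} {w w' p q : ℂ} (hq : q ∈ A)
    (hpq : p ≠ q) (hwp : ∀ a ∈ A, ‖w - p‖ ≤ ‖w - a‖) (hwq : ∀ a ∈ A, ‖w' - q‖ ≤ ‖w' - a‖) :
    ∃ u ∈ segment ℝ w w', ∃ b ∈ A, b ≠ p ∧ (∀ a ∈ A, ‖u - p‖ ≤ ‖u - a‖) ∧
      ∀ a ∈ A, ‖u - b‖ ≤ ‖u - a‖ := by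
  have hclosed : ∀ b : ℂ, IsClosed {u : ℂ | ∀ a ∈ A, ‖u - b‖ ≤ ‖u - a‖} := by
    intro b
    simp only [Set.ofPred_forall]
    exact isClosed_iInter fun a ↦ isClosed_iInter fun _ ↦ isClosed_le (by fun_prop) (by fun_prop)
  have := isPreconnected_closed_iff.1 (convex_segment (𝕜 := ℝ) w w').isPreconnected
    {u : ℂ | ∀ a ∈ A, ‖u - p‖ ≤ ‖u - a‖}
    (⋃ b ∈ A.erase p, {u : ℂ | ∀ a ∈ A, ‖u - b‖ ≤ ‖u - a‖}) (hclosed p)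
    ((A.erase p).finite_toSet.isClosed_biUnion fun b _ ↦ hclosed b) ?_
    ⟨w, left_mem_segment _ _ _, hwp⟩
    ⟨w', right_mem_segment _ _ _,
      Set.mem_biUnion (Finset.mem_coe.2 (Finset.mem_erase.2 ⟨hpq.symm, hq⟩)) hwq⟩
  · obtain ⟨u, hu, hup, hub⟩ := this
    simp only [Set.mem_iUnion, Finset.mem_erase] at hub
    obtain ⟨b, ⟨hbp, hb⟩, hub⟩ := hub
    exact ⟨u, hu, b, hb, hbp, hup, hub⟩
  · intro u _
    obtain ⟨b, hb, hbmin⟩ := A.exists_min_image (fun a ↦ ‖u - a‖) ⟨q, hq⟩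
    by_cases hbp : b = p
    · exact Or.inl (hbp ▸ hbmin)
    · exact Or.inr (Set.mem_biUnion (Finset.mem_coe.2 (Finset.mem_erase.2 ⟨hbp, hb⟩)) hbmin)

/-- The form of `exists_separating_pairs` for alphabets in which no two elements have the same real
part. Along each horizontal line the Voronoi cells then appear in the order of the real parts of
their centres, so the pairs consecutive on some horizontal line can be counted by
`card_consecutive_pairs_le`, with the height of the line as time. -/
theorem exists_separating_pairs_of_injOn_re (A : Finset ℂ) (hA : Set.InjOn Complex.re A) :
    ∃ E : Finset (ℂ × ℂ), E.card ≤ 3 * A.card ∧ (∀ e ∈ E, e.1 ≠ e.2) ∧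
      ∀ w w' p q : ℂ, p ∈ A → q ∈ A → p ≠ q → (∀ a ∈ A, ‖w - p‖ ≤ ‖w - a‖) →
        (∀ a ∈ A, ‖w' - q‖ ≤ ‖w' - a‖) →
        ∃ e ∈ E, ∃ u ∈ segment ℝ w w', ‖u - e.1‖ = ‖u - e.2‖ := by
  classical
  let active : ℝ → ℂ → Prop := fun t a ↦ ∃ x, IsStrictlyNearest A a x t
  let Adj : ℂ × ℂ → Prop := fun e ↦ ∃ t, active t e.1 ∧ active t e.2 ∧ e.1.re < e.2.re ∧
      ∀ c ∈ A, active t c → ¬ (e.1.re < c.re ∧ c.re < e.2.re)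
  refine ⟨(A ×ˢ A).filter Adj, ?_, ?_, ?_⟩
  · exact card_consecutive_pairs_le A Complex.re hA active
      (fun a ↦ (convex_heights A a).ordConnected) _
      (fun e he ↦ Finset.mem_product.1 (Finset.mem_filter.1 he).1)
      (fun e he ↦ (Finset.mem_filter.1 he).2)
  · rintro e he heq
    obtain ⟨t, -, -, hlt, -⟩ := (Finset.mem_filter.1 he).2
    exact hlt.ne (by rw [heq])
  intro w w' p q hp hq hpq hwp hwq
  obtain ⟨u, hu, b, hb, hbp, hup, hub⟩ := exists_tie_of_segment hq hpq hwp hwq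
  -- `l` and `r` are the extreme elements nearest to `u`. Just left of `u` only `l` is nearest, just
  -- right of it only `r`, so that they are consecutive on the horizontal line through `u`.
  let K := A.filter fun k ↦ ∀ a ∈ A, ‖u - k‖ ≤ ‖u - a‖
  have hpK : p ∈ K := Finset.mem_filter.2 ⟨hp, hup⟩
  have hbK : b ∈ K := Finset.mem_filter.2 ⟨hb, hub⟩
  obtain ⟨l, hlK, hl⟩ := K.exists_min_image Complex.re ⟨p, hpK⟩
  obtain ⟨r, hrK, hr⟩ := K.exists_max_image Complex.re ⟨p, hpK⟩
  obtain ⟨hlA, hlmin⟩ := Finset.mem_filter.1 hlK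
  obtain ⟨hrA, hrmin⟩ := Finset.mem_filter.1 hrK
  have hmemK : ∀ {k c}, k ∈ K → c ∈ A → ‖u - c‖ = ‖u - k‖ → c ∈ K := fun hk hc h ↦
    Finset.mem_filter.2 ⟨hc, fun a ha ↦ h.le.trans ((Finset.mem_filter.1 hk).2 a ha)⟩
  have hlr : l.re < r.re := by
    refine lt_of_le_of_ne (hl r hrK) fun h ↦ hbp (hA hb hp ?_)
    exact le_antisymm ((hr b hbK).trans (h ▸ hl p hpK)) ((hr p hpK).trans (h ▸ hl b hbK))
  have hlr_eq : ‖u - l‖ = ‖u - r‖ := le_antisymm (hlmin r hrA) (hrmin l hlA)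
  refine ⟨(l, r), Finset.mem_filter.2 ⟨Finset.mem_product.2 ⟨hlA, hrA⟩, u.im, ?_, ?_, hlr, ?_⟩,
    u, hu, hlr_eq⟩
  · refine exists_isStrictlyNearest (σ := -1) hlmin fun c hc hcl hn ↦ ?_
    have h1 := hl c (hmemK hlK hc hn)
    have h2 : l.re ≠ c.re := fun h ↦ hcl (hA hc hlA h.symm)
    have := lt_of_le_of_ne h1 h2
    linarith
  · refine exists_isStrictlyNearest (σ := 1) hrmin fun c hc hcr hn ↦ ?_
    have h1 := hr c (hmemK hrK hc hn)
    have h2 : c.re ≠ r.re := fun h ↦ hcr (hA hc hrA h)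
    have := lt_of_le_of_ne h1 h2
    linarith
  · rintro c hc ⟨x, hx⟩ ⟨hlc, hcr⟩
    have h1 := hx l hlA (fun h ↦ by simp [h] at hlc)
    have h2 := hx r hrA (fun h ↦ by simp [h] at hcr)
    have h3 := (norm_sub_le_norm_sub_iff _ _ _).1 (hlmin c hc)
    have h4 := (norm_sub_le_norm_sub_iff _ _ _).1 (hrmin c hc)
    rcases le_total u.re x with hux | hux <;> nlinarith

/-- The perpendicular bisectors of at most `3 * A.card` pairs of distinct points separate the Voronoi
cells of `A`: a segment between points with different nearest elements meets one of them. -/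
theorem exists_separating_pairs (A : Finset ℂ) :
    ∃ E : Finset (ℂ × ℂ), E.card ≤ 3 * A.card ∧ (∀ e ∈ E, e.1 ≠ e.2) ∧
      ∀ w w' p q : ℂ, p ∈ A → q ∈ A → p ≠ q → (∀ a ∈ A, ‖w - p‖ ≤ ‖w - a‖) →
        (∀ a ∈ A, ‖w' - q‖ ≤ ‖w' - a‖) →
        ∃ e ∈ E, ∃ u ∈ segment ℝ w w', ‖u - e.1‖ = ‖u - e.2‖ := by
  classical
  -- Multiplication by `1 - s * I` is a similarity, and for all but finitely many `s` it makes the real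
  -- parts of the elements of `A` distinct.
  obtain ⟨s, hs⟩ := Set.Infinite.exists_notMem_finset Set.infinite_univ
    ((A ×ˢ A).image fun e ↦ (e.2.re - e.1.re) / (e.1.im - e.2.im)) |>.imp fun s h ↦ h.2
  let c : ℂ := ⟨1, -s⟩
  have hc0 : c ≠ 0 := fun h ↦ by simpa [c] using congrArg Complex.re h
  have hre : ∀ z : ℂ, (c * z).re = z.re + s * z.im := fun z ↦ by simp [c]
  have hinj : Set.InjOn Complex.re (A.image (c * ·) : Finset ℂ) := by
    intro x hx y hy hxy
    obtain ⟨a, ha, rfl⟩ := Finset.mem_image.1 hx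
    obtain ⟨b, hb, rfl⟩ := Finset.mem_image.1 hy
    rw [hre, hre] at hxy
    by_cases him : a.im = b.im
    · have : a = b := Complex.ext (by rw [him] at hxy; linarith) him
      rw [this]
    · refine absurd (Finset.mem_image.2 ⟨(a, b), Finset.mem_product.2 ⟨ha, hb⟩, ?_⟩) hs
      rw [div_eq_iff (sub_ne_zero.2 him)]
      linarith
  have hnorm : ∀ x y : ℂ, ‖c * x - c * y‖ = ‖c‖ * ‖x - y‖ := fun x y ↦ by
    rw [← mul_sub, norm_mul]
  have hcpos : 0 < ‖c‖ := norm_pos_iff.2 hc0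
  obtain ⟨E, hcard, hne, hE⟩ := exists_separating_pairs_of_injOn_re _ hinj
  refine ⟨E.image fun e ↦ (c⁻¹ * e.1, c⁻¹ * e.2), ?_, ?_, ?_⟩
  · exact Finset.card_image_le.trans (hcard.trans (Nat.mul_le_mul_left 3 Finset.card_image_le))
  · intro e he
    obtain ⟨e', he', rfl⟩ := Finset.mem_image.1 he
    simpa [hc0] using hne e' he'
  intro w w' p q hp hq hpq hw hw'
  obtain ⟨e, he, u, hu, heq⟩ := hE (c * w) (c * w') (c * p) (c * q)
    (Finset.mem_image_of_mem _ hp) (Finset.mem_image_of_mem _ hq)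
    (fun h ↦ hpq (mul_left_cancel₀ hc0 h))
    (by
      simp only [Finset.forall_mem_image, hnorm]
      exact fun a ha ↦ mul_le_mul_of_nonneg_left (hw a ha) hcpos.le)
    (by
      simp only [Finset.forall_mem_image, hnorm]
      exact fun a ha ↦ mul_le_mul_of_nonneg_left (hw' a ha) hcpos.le)
  obtain ⟨α, β, hα, hβ, hαβ, rfl⟩ := hu
  refine ⟨_, Finset.mem_image_of_mem _ he, α • w + β • w', ⟨α, β, hα, hβ, hαβ, rfl⟩, ?_⟩
  have hcc : ∀ y : ℂ, ‖α • (c * w) + β • (c * w') - y‖ =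
      ‖c‖ * ‖α • w + β • w' - c⁻¹ * y‖ := by
    intro y
    rw [← hnorm, mul_inv_cancel_left₀ hc0, mul_add, mul_smul_comm, mul_smul_comm]
  rw [hcc, hcc] at heq
  exact mul_left_cancel₀ hcpos.ne' heq

end Voronoi

section Arrangement

open Finset MeasureTheory

/-! ### Sums of binomial coefficients -/

theorem sum_choose_le_exp_mul_div_pow {n d : ℕ} (hd : 0 < d) (hdn : d ≤ n) :
    (∑ k ∈ Iic d, (n.choose k : ℝ)) ≤ (Real.exp 1 * n / d) ^ d := by
  have hn : 0 < n := hd.trans_le hdn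
  have hd' : (0 : ℝ) < d := by exact_mod_cast hd
  have hn' : (0 : ℝ) < n := by exact_mod_cast hn
  set x : ℝ := d / n with hx
  have hx0 : 0 < x := by positivity
  have hx1 : x ≤ 1 := (div_le_one hn').2 (by exact_mod_cast hdn)
  -- `x ^ d ≤ x ^ k` for `k ≤ d`, so the sum is at most `x ^ (-d) * (1 + x) ^ n`.
  have h1 : x ^ d * ∑ k ∈ Iic d, (n.choose k : ℝ) ≤ (x + 1) ^ n := by
    rw [add_pow, mul_sum]
    refine (sum_le_sum fun k hk ↦ ?_).trans
      (sum_le_sum_of_subset_of_nonneg (s := Iic d) (fun k hk ↦ ?_) fun k _ _ ↦ by positivity)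
    · rw [one_pow, mul_one]
      exact mul_le_mul_of_nonneg_right (pow_le_pow_of_le_one hx0.le hx1 (mem_Iic.1 hk))
        (Nat.cast_nonneg _)
    · exact mem_range.2 (Nat.lt_succ_of_le ((mem_Iic.1 hk).trans hdn))
  have h2 : (x + 1) ^ n ≤ Real.exp 1 ^ d := by
    refine (pow_le_pow_left₀ (by positivity) (Real.add_one_le_exp x) n).trans_eq ?_
    rw [← Real.exp_nat_mul, ← Real.exp_nat_mul, hx, mul_div_cancel₀ _ hn'.ne', mul_one]
  have h3 : (Real.exp 1 * n / d) ^ d = Real.exp 1 ^ d / x ^ d := by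
    rw [← div_pow, hx, div_div_eq_mul_div]
  rw [h3, le_div_iff₀' (by positivity)]
  exact h1.trans h2

theorem sum_choose_le_two_pow (n d : ℕ) : ∑ k ∈ Iic d, n.choose k ≤ 2 ^ n := by
  rw [← Nat.sum_range_choose]
  rw [← sum_filter_add_sum_filter_not (Iic d) (· ≤ n),
    sum_eq_zero (s := (Iic d).filter fun k ↦ ¬ k ≤ n)
      (fun k hk ↦ Nat.choose_eq_zero_of_lt (not_le.1 (mem_filter.1 hk).2)), add_zero]
  exact sum_le_sum_of_subset fun k hk ↦
    mem_range.2 (Nat.lt_succ_of_le (mem_filter.1 hk).2)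

/-- The number of cells of `n ≤ N` hyperplanes in dimension `d` is too small for balls of the given
radius `ε` to cover the unit ball. For `d ≤ N` it is at most `(e * N / d) ^ d`, and otherwise at most
`2 ^ d`. -/
theorem sum_choose_mul_pow_lt_one {d n N : ℕ} {ε : ℝ} (hd : 0 < d) (hn : n ≤ N) (hε : 0 ≤ ε)
    (hε4 : ε ≤ 1 / 4) (hεN : ε * (2 * (Real.exp 1 * N)) ≤ d) :
    (∑ k ∈ Iic d, (n.choose k : ℝ)) * ε ^ d < 1 := by
  have hhalf : ((1 : ℝ) / 2) ^ d < 1 := pow_lt_one₀ (by norm_num) (by norm_num) hd.ne'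
  have hd' : (0 : ℝ) < d := by exact_mod_cast hd
  rcases le_or_gt d N with hdN | hdN
  · refine lt_of_le_of_lt ?_ hhalf
    have hmono : ∑ k ∈ Iic d, (n.choose k : ℝ) ≤ (Real.exp 1 * N / d) ^ d :=
      le_trans (sum_le_sum fun k _ ↦ by exact_mod_cast Nat.choose_le_choose k hn)
        (sum_choose_le_exp_mul_div_pow hd hdN)
    refine (mul_le_mul_of_nonneg_right hmono (by positivity)).trans ?_
    rw [← mul_pow]
    refine pow_le_pow_left₀ (by positivity) ?_ d
    rw [div_mul_eq_mul_div, div_le_div_iff₀ hd' two_pos]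
    linarith
  · refine lt_of_le_of_lt ?_ hhalf
    have h2 : ∑ k ∈ Iic d, (n.choose k : ℝ) ≤ 2 ^ d := by
      have := (sum_choose_le_two_pow n d).trans
        (Nat.pow_le_pow_right two_pos (hn.trans hdN.le))
      exact_mod_cast this
    refine (mul_le_mul_of_nonneg_right h2 (by positivity)).trans ?_
    rw [← mul_pow]
    exact pow_le_pow_left₀ (by positivity) (by linarith) d

/-! ### Cells of hyperplane arrangements -/

open Classical in
/-- The sign patterns of the affine functionals `z ↦ g i z + c i` at points where none of them
vanishes. A pattern is encoded as the set of indices at which the sign is positive; it corresponds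
to an open cell of the arrangement of the hyperplanes `g i z + c i = 0`. -/
noncomputable def signPatterns {V ι : Type*} [AddCommGroup V] [Module ℝ V] [Fintype ι]
    (g : ι → Module.Dual ℝ V) (c : ι → ℝ) : Finset (Finset ι) :=
  univ.filter fun s ↦ ∃ z, ∀ i, (i ∈ s → 0 < g i z + c i) ∧ (i ∉ s → g i z + c i < 0)

/-- More affine functionals than the dimension cannot take all sign patterns: some nontrivial
combination of them is a constant `κ`, and choosing the sign of each functional as that of its
coefficient (if `κ ≤ 0`, else the opposite one) would force `κ` to have the wrong sign. -/
theorem not_shatters_signPatterns {V ι : Type*} [AddCommGroup V] [Module ℝ V]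
    [FiniteDimensional ℝ V] [Fintype ι] [DecidableEq ι] (g : ι → Module.Dual ℝ V) (c : ι → ℝ)
    {s : Finset ι} (hs : Module.finrank ℝ V < s.card) : ¬ (signPatterns g c).Shatters s := by
  classical
  intro hsh
  obtain ⟨f, hf, i₀, hi₀⟩ : ∃ f : s → ℝ, ∑ i, f i • g i = 0 ∧ ∃ i, f i ≠ 0 := by
    refine Fintype.not_linearIndependent_iff.1 fun h ↦ ?_
    have := h.fintype_card_le_finrank
    rw [Fintype.card_coe, Subspace.dual_finrank_eq] at this
    omega
  -- Replacing `f` by `-f`, the constant `∑ f i * c i` may be assumed nonpositive.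
  wlog hc : ∑ i, f i * c i ≤ 0 generalizing f
  · refine this (-f) ?_ (by simpa using hi₀) ?_
    · ext z
      have := LinearMap.congr_fun hf z
      simp only [LinearMap.sum_apply, LinearMap.smul_apply, LinearMap.zero_apply, smul_eq_mul,
        Pi.neg_apply, neg_mul, sum_neg_distrib] at this ⊢
      rw [this, neg_zero]
    · simp only [Pi.neg_apply, neg_mul, sum_neg_distrib]
      linarith
  obtain ⟨u, hu, hsu⟩ := @hsh (s.filter fun i ↦ ∃ h : i ∈ s, 0 < f ⟨i, h⟩) (filter_subset _ _)
  obtain ⟨z, hz⟩ := (mem_filter.1 hu).2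
  have hmem : ∀ i : s, (i : ι) ∈ u ↔ 0 < f i := by
    intro i
    have := Finset.ext_iff.1 hsu i
    simpa [i.2] using this
  have hterm : ∀ i : s, 0 ≤ f i * (g i z + c i) ∧ (f i ≠ 0 → 0 < f i * (g i z + c i)) := by
    intro i
    rcases lt_trichotomy (f i) 0 with h | h | h
    · have := mul_pos_of_neg_of_neg h ((hz i).2 fun hi ↦ h.not_gt ((hmem i).1 hi))
      exact ⟨this.le, fun _ ↦ this⟩
    · simp [h]
    · have := mul_pos h ((hz i).1 ((hmem i).2 h))
      exact ⟨this.le, fun _ ↦ this⟩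
  have hpos : 0 < ∑ i, f i * (g i z + c i) :=
    sum_pos' (fun i _ ↦ (hterm i).1) ⟨i₀, mem_univ _, (hterm i₀).2 hi₀⟩
  have hzero : ∑ i, f i * g i z = 0 := by
    simpa using LinearMap.congr_fun hf z
  simp only [mul_add, sum_add_distrib, hzero] at hpos
  linarith

/-- The number of open cells of an arrangement of `n` affine hyperplanes in dimension `d` is at most
the sum of the binomial coefficients `n.choose k` with `k ≤ d`, by the Sauer-Shelah lemma. -/
theorem card_signPatterns_le {V ι : Type*} [AddCommGroup V] [Module ℝ V]
    [FiniteDimensional ℝ V] [Fintype ι] (g : ι → Module.Dual ℝ V) (c : ι → ℝ) :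
    (signPatterns g c).card ≤ ∑ k ∈ Iic (Module.finrank ℝ V), (Fintype.card ι).choose k := by
  classical
  refine (card_le_card_shatterer _).trans (card_shatterer_le_sum_vcDim.trans ?_)
  refine sum_le_sum_of_subset (Iic_subset_Iic.2 (Finset.sup_le fun s hs ↦ ?_))
  exact not_lt.1 fun h ↦ not_shatters_signPatterns g c h (mem_shatterer.1 hs)

/-! ### Hyperplanes that determine the quantization -/

/-- Rounding the value of a linear map `f` is determined, off at most `3 * A.card` hyperplanes, by the
sign pattern of the corresponding affine functionals. If `f` is surjective the functionals are
`z ↦ ‖f z - a‖ ^ 2 - ‖f z - b‖ ^ 2`, for the separating pairs `(a, b)`. If `f = 0` none is needed,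
and none could be used, as they would all be constant. -/
theorem exists_functionals_determining_rounding {V : Type*} [AddCommGroup V] [Module ℝ V]
    (f : V →ₗ[ℝ] ℂ) (hf : f = 0 ∨ Function.Surjective f) (A : Finset ℂ) {r : ℂ → A}
    (hr : IsNearestRounding A r) :
    ∃ H : Finset (Module.Dual ℝ V × ℝ), H.card ≤ 3 * A.card ∧ (∀ h ∈ H, h.1 ≠ 0) ∧
      ∀ z z', (∀ h ∈ H, (0 < h.1 z + h.2 ∧ 0 < h.1 z' + h.2) ∨
        (h.1 z + h.2 < 0 ∧ h.1 z' + h.2 < 0)) → r (f z) = r (f z') := by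
  classical
  rcases hf with rfl | hf
  · exact ⟨∅, by simp, by simp, by simp⟩
  obtain ⟨E, hcard, hne, hE⟩ := exists_separating_pairs A
  let φ : ℂ × ℂ → Module.Dual ℝ V × ℝ := fun e ↦
    (((2 * (e.2.re - e.1.re)) • Complex.reLm + (2 * (e.2.im - e.1.im)) • Complex.imLm) ∘ₗ f,
      e.1.re ^ 2 + e.1.im ^ 2 - (e.2.re ^ 2 + e.2.im ^ 2))
  have hφ : ∀ e z, (φ e).1 z + (φ e).2 = ((f z).re - e.1.re) ^ 2 + ((f z).im - e.1.im) ^ 2 -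
      (((f z).re - e.2.re) ^ 2 + ((f z).im - e.2.im) ^ 2) := by
    intro e z
    simp only [φ, LinearMap.comp_apply, LinearMap.add_apply, LinearMap.smul_apply,
      Complex.reLm_coe, Complex.imLm_coe, smul_eq_mul]
    ring
  refine ⟨E.image φ, card_image_le.trans hcard, ?_, ?_⟩
  · intro h hh h0
    obtain ⟨e, he, rfl⟩ := mem_image.1 hh
    obtain ⟨z, hz⟩ := hf (e.2 - e.1)
    have := LinearMap.congr_fun h0 z
    simp only [φ, LinearMap.comp_apply, LinearMap.add_apply, LinearMap.smul_apply, hz,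
      Complex.reLm_coe, Complex.imLm_coe, smul_eq_mul, LinearMap.zero_apply, Complex.sub_re,
      Complex.sub_im] at this
    have hre : (e.2.re - e.1.re) ^ 2 = 0 := by nlinarith [sq_nonneg (e.2.im - e.1.im)]
    have him : (e.2.im - e.1.im) ^ 2 = 0 := by nlinarith [sq_nonneg (e.2.re - e.1.re)]
    exact hne e he (Complex.ext (by linarith [pow_eq_zero_iff two_ne_zero |>.1 hre])
      (by linarith [pow_eq_zero_iff two_ne_zero |>.1 him]))
  intro z z' hzz
  by_contra hrr
  obtain ⟨e, he, u, hu, heq⟩ := hE (f z) (f z') (r (f z)) (r (f z')) (r (f z)).2 (r (f z')).2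
    (fun h ↦ hrr (Subtype.ext h)) (hr (f z)) (hr (f z'))
  obtain ⟨α, β, hα, hβ, hαβ, rfl⟩ := hu
  have hval : α * ((φ e).1 z + (φ e).2) + β * ((φ e).1 z' + (φ e).2) = 0 := by
    have h0 : (φ e).1 (α • z + β • z') + (φ e).2 = 0 := by
      rw [hφ, map_add, map_smul, map_smul, sub_eq_zero]
      exact le_antisymm ((norm_sub_le_norm_sub_iff _ _ _).1 heq.le)
        ((norm_sub_le_norm_sub_iff _ _ _).1 heq.ge)
    rw [map_add, map_smul, map_smul, smul_eq_mul, smul_eq_mul] at h0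
    linear_combination h0 + (φ e).2 * hαβ
  rcases hα.eq_or_lt with rfl | hα
  · obtain rfl : β = 1 := by linarith
    rcases hzz _ (mem_image_of_mem φ he) with h | h <;> linarith [h.1, h.2]
  · rcases hzz _ (mem_image_of_mem φ he) with h | h
    · linarith [mul_pos hα h.1, mul_nonneg hβ h.2.le]
    · linarith [mul_neg_of_pos_of_neg hα h.1, mul_nonpos_of_nonneg_of_nonpos hβ h.2.le]

/-! ### Comparison of volumes -/

theorem addHaar_affine_hyperplane {V : Type*} [NormedAddCommGroup V] [NormedSpace ℝ V]
    [MeasurableSpace V] [BorelSpace V] [FiniteDimensional ℝ V] (μ : Measure V)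
    [μ.IsAddHaarMeasure] {g : Module.Dual ℝ V} (hg : g ≠ 0) (c : ℝ) :
    μ {z | g z + c = 0} = 0 := by
  rcases Set.eq_empty_or_nonempty {z | g z + c = 0} with h | ⟨z₀, hz₀⟩
  · rw [h, measure_empty]
  have : {z | g z + c = 0} = (fun z ↦ z + -z₀) ⁻¹' (LinearMap.ker g : Set V) := by
    ext z
    have hz₀ : g z₀ + c = 0 := hz₀
    change g z + c = 0 ↔ g (z + -z₀) = 0
    rw [map_add, map_neg]
    constructor <;> intro h <;> linarith
  rw [this, measure_preimage_add_right]
  exact Measure.addHaar_submodule μ _ fun h ↦ hg (LinearMap.ker_eq_top.1 h)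

/-- Up to a null set the unit ball is covered by the cells of the hyperplane arrangement `H`. If `q` is
constant on each cell and `D ∘ q` reproduces the unit ball up to `ε`, then the part of the ball in
each cell lies in one ball of radius `ε`, and comparing volumes bounds `ε` from below. -/
theorem one_le_sum_choose_mul_pow {V X : Type*} [NormedAddCommGroup V] [NormedSpace ℝ V]
    [FiniteDimensional ℝ V] (H : Finset (Module.Dual ℝ V × ℝ)) (hH : ∀ h ∈ H, h.1 ≠ 0)
    (q : V → X) (hq : ∀ z z', (∀ h ∈ H, (0 < h.1 z + h.2 ∧ 0 < h.1 z' + h.2) ∨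
        (h.1 z + h.2 < 0 ∧ h.1 z' + h.2 < 0)) → q z = q z')
    (D : X → V) {ε : ℝ} (hε : 0 ≤ ε) (hD : ∀ z, ‖z‖ ≤ 1 → ‖z - D (q z)‖ ≤ ε) :
    (1 : ℝ) ≤ (∑ k ∈ Iic (Module.finrank ℝ V), (H.card.choose k : ℝ)) *
      ε ^ Module.finrank ℝ V := by
  classical
  borelize V
  let μ : Measure V := Measure.addHaar
  let P := signPatterns (fun h : H ↦ h.1.1) (fun h : H ↦ h.1.2)
  have hP : ∀ s ∈ P, ∃ z, ∀ h : H,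
      (h ∈ s → 0 < h.1.1 z + h.1.2) ∧ (h ∉ s → h.1.1 z + h.1.2 < 0) :=
    fun s hs ↦ (mem_filter.1 hs).2
  choose! z hz using hP
  have hcover : Metric.closedBall (0 : V) 1 ⊆
      (⋃ h ∈ H, {x | h.1 x + h.2 = 0}) ∪ ⋃ s ∈ P, Metric.closedBall (D (q (z s))) ε := by
    intro x hx
    by_cases hx0 : ∃ h ∈ H, h.1 x + h.2 = 0
    · obtain ⟨h, hh, hx0⟩ := hx0
      exact Or.inl (Set.mem_biUnion (mem_coe.2 hh) hx0)
    push Not at hx0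
    right
    let s : Finset H := univ.filter fun h ↦ 0 < h.1.1 x + h.1.2
    have hs : ∀ h : H, (h ∈ s → 0 < h.1.1 x + h.1.2) ∧ (h ∉ s → h.1.1 x + h.1.2 < 0) :=
      fun h ↦ ⟨fun hh ↦ (mem_filter.1 hh).2, fun hh ↦ lt_of_le_of_ne
        (not_lt.1 fun h' ↦ hh (mem_filter.2 ⟨mem_univ _, h'⟩)) (hx0 _ h.2)⟩
    have hsP : s ∈ P := mem_filter.2 ⟨mem_univ _, x, hs⟩
    refine Set.mem_biUnion (mem_coe.2 hsP) ?_
    rw [← hq x (z s) fun h hh ↦ ?_]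
    · rw [mem_closedBall_iff_norm]
      exact hD x (by simpa using hx)
    · by_cases hhs : (⟨h, hh⟩ : H) ∈ s
      · exact Or.inl ⟨(hs ⟨h, hh⟩).1 hhs, (hz s hsP ⟨h, hh⟩).1 hhs⟩
      · exact Or.inr ⟨(hs ⟨h, hh⟩).2 hhs, (hz s hsP ⟨h, hh⟩).2 hhs⟩
  have hnull : μ (⋃ h ∈ H, {x | h.1 x + h.2 = 0}) = 0 :=
    (measure_biUnion_null_iff H.countable_toSet).2
      fun h hh ↦ addHaar_affine_hyperplane μ (hH h hh) h.2
  have hμ : μ (Metric.closedBall 0 1) ≤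
      P.card * (ENNReal.ofReal (ε ^ Module.finrank ℝ V) * μ (Metric.closedBall 0 1)) := by
    refine (measure_mono hcover).trans ((measure_union_le _ _).trans ?_)
    rw [hnull, zero_add]
    refine (measure_biUnion_finset_le _ _).trans_eq ?_
    simp_rw [Measure.addHaar_closedBall' μ _ hε]
    rw [sum_const, nsmul_eq_mul]
  have hpos : μ (Metric.closedBall (0 : V) 1) ≠ 0 :=
    (Metric.measure_closedBall_pos μ _ one_pos).ne'
  have hfin : μ (Metric.closedBall (0 : V) 1) ≠ ⊤ := measure_closedBall_lt_top.ne
  rw [← mul_assoc] at hμ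
  have h1 : (1 : ENNReal) ≤ P.card * ENNReal.ofReal (ε ^ Module.finrank ℝ V) := by
    rw [← ENNReal.mul_le_mul_iff_left hpos hfin, one_mul]
    exact hμ
  rw [← ENNReal.ofReal_natCast, ← ENNReal.ofReal_mul (Nat.cast_nonneg _),
    ENNReal.one_le_ofReal] at h1
  refine h1.trans (mul_le_mul_of_nonneg_right ?_ (by positivity))
  have := card_signPatterns_le (fun h : H ↦ h.1.1) (fun h : H ↦ h.1.2)
  rw [Fintype.card_coe] at this
  exact_mod_cast this

/-! ### The lower bound for the minimax error -/

theorem theorem7p1 {M S L : ℕ} (Ψ : Matrix (Fin M) (Fin S) ℂ) (hΨ : IsFrameMatrix Ψ)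
    (A : Finset ℂ) (hA : A.card = L)
    (Q : (Fin M → ℂ) → (Fin M → A)) (hQ : IsMSQ A Q) :
    ENNReal.ofReal (min (1 / 4) ((S : ℝ) / (3 * Real.exp 1 * (L : ℝ) * (M : ℝ)))) ≤
      minimaxError Ψ Q := by
  classical
  set ε : ℝ := min (1 / 4) ((S : ℝ) / (3 * Real.exp 1 * (L : ℝ) * (M : ℝ))) with hεdef
  have hε : 0 ≤ ε := le_min (by norm_num) (by positivity)
  rcases Nat.eq_zero_or_pos S with hS | hS
  · have : ε ≤ 0 := by simp [hεdef, hS]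
    rw [ENNReal.ofReal_of_nonpos this]
    exact zero_le
  obtain ⟨r, hr, hQr⟩ := hQ
  -- If the supremum for `D` were smaller than `ε`, the unit ball would be reproduced up to `ε`.
  refine le_iInf fun D ↦ ?_
  by_contra! hlt
  have hDlt : ∀ z : EuclideanSpace ℂ (Fin S), ‖z‖ ≤ 1 → ‖z - D (Q (Ψ *ᵥ z.ofLp))‖ ≤ ε := by
    intro z hz
    rw [← ENNReal.ofReal_le_ofReal_iff hε, ofReal_norm]
    exact (le_iSup₂ (f := fun (z : EuclideanSpace ℂ (Fin S)) (_ : z ∈ Metric.closedBall 0 1) ↦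
      ‖z - D (Q (Ψ *ᵥ z.ofLp))‖ₑ) z (by simpa using hz)).trans hlt.le
  let f : Fin M → EuclideanSpace ℂ (Fin S) →ₗ[ℂ] ℂ := fun j ↦
    LinearMap.proj j ∘ₗ Ψ.mulVecLin ∘ₗ (WithLp.linearEquiv 2 ℂ (Fin S → ℂ)).toLinearMap
  have hf : ∀ j z, f j z = (Ψ *ᵥ z.ofLp) j := fun j z ↦ rfl
  have hrow : ∀ j, (f j).restrictScalars ℝ = 0 ∨
      Function.Surjective ((f j).restrictScalars ℝ) := by
    intro j
    by_cases h0 : f j = 0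
    · left; rw [h0]; rfl
    · exact Or.inr (LinearMap.surjective h0)
  choose H hcard hne hH using fun j ↦
    exists_functionals_determining_rounding _ (hrow j) A (hr j)
  have hdim : Module.finrank ℝ (EuclideanSpace ℂ (Fin S)) = 2 * S := by
    rw [finrank_real_of_complex, finrank_euclideanSpace_fin]
  have h1 := one_le_sum_choose_mul_pow (univ.biUnion H)
    (fun h hh ↦ by
      obtain ⟨j, -, hj⟩ := mem_biUnion.1 hh
      exact hne j h hj)
    (fun z ↦ Q (Ψ *ᵥ z.ofLp))
    (fun z z' hzz ↦ by
      funext j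
      rw [hQr, hQr]
      exact hH j z z' fun h hh ↦ hzz h (mem_biUnion.2 ⟨j, mem_univ _, hh⟩))
    D hε hDlt
  rw [hdim] at h1
  have hn : (univ.biUnion H).card ≤ 3 * L * M := by
    refine card_biUnion_le.trans ((sum_le_card_nsmul _ _ _ fun j _ ↦ hcard j).trans_eq ?_)
    rw [card_univ, Fintype.card_fin, hA, smul_eq_mul, mul_comm]
  refine absurd h1 (not_le.2 (sum_choose_mul_pow_lt_one (by omega) hn hε (min_le_left _ _) ?_))
  push_cast
  have h2 : ε * (3 * Real.exp 1 * L * M) ≤ S := by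
    refine (mul_le_mul_of_nonneg_right (min_le_right _ _) (by positivity)).trans ?_
    rcases eq_or_ne (3 * Real.exp 1 * (L : ℝ) * M) 0 with h0 | h0
    · rw [h0, mul_zero]
      positivity
    · exact (div_mul_cancel₀ _ h0).le
  linarith

end Arrangement
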